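/- Let $q\ge 1$ and equip $\mathbb{R}^q$ with the Euclidean metric $d$; write $B(x,\epsilon)$ for the closed ball of centre $x$ and radius $\epsilon$, $|B|$ for the diameter of a set $B$, and $d(x,\alpha)=\inf_{a\in\alpha}d(x,a)$. Let $\mu$ be a Borel probability measure on $\mathbb{R}^q$ with support $K_\mu$, and assume that $\mu$ is an Ahlfors–David measure: there are $s_0>0$, $\epsilon_0>0$ and $C_1,C_2>0$ such that $$C_1\epsilon^{s_0}\le\mu(B(x,\epsilon))\le C_2\epsilon^{s_0}\qquad\text{for all }x\in K_\mu\text{ and }0<\epsilon<\epsilon_0 .$$ For $n\ge 1$, a set $\alpha_n\subset\mathbb{R}^q$ with $1\le\operatorname{card}(\alpha_n)\le n$ is called $n$-optimal for $\mu$ with respect to the geometric mean error if $$\exp\Big(\int\log d(x,\alpha_n)\,d\mu(x)\Big)=\inf\Big\{\exp\Big(\int\log d(x,\alpha)\,d\mu(x)\Big):\alpha\subset\mathbb{R}^q,\ 1\le\operatorname{card}(\alpha)\le n\Big\}.$$ A Voronoi partition with respect to a non-empty finite set $\alpha$ is a partition $\{P_a(\alpha)\}_{a\in\alpha}$ of $\mathbb{R}^q$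 into Borel sets such that $P_a(\alpha)\subset\{x\in\mathbb{R}^q: d(x,\alpha)=d(x,a)\}$ for every $a\in\alpha$. **Theorem.** There exist constants $d_1,d_2,d_3>0$ (depending only on $\mu$) such that for every $n\ge 1$, every $n$-optimal set $\alpha_n$ for $\mu$ with respect to the geometric mean error, and every Voronoi partition $\{P_a(\alpha_n)\}_{a\in\alpha_n}$ with respect to $\alpha_n$, $$\frac{d_1}{n}\le\min_{a\in\alpha_n}\mu(P_a(\alpha_n))\le\max_{a\in\alpha_n}\mu(P_a(\alpha_n))\le\frac{d_2}{n}.$$ Moreover, for every $a\in\alpha_n$, the set $P_a(\alpha_n)$ contains the closed ball of radius $d_3\,|P_a(\alpha_n)\cap K_\mu|$ centred at $a$. -/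

import Mathlib

open MeasureTheory

noncomputable section

namespace GeomMeanQuant

/-- `μ` is an `s`-dimensional Ahlfors-David measure on `ℝ^q`, with `s > 0`: the measure of a closed
ball centred in the support is comparable with the `s`-th power of its (small) radius. -/
def IsAhlforsDavid {q : ℕ} (μ : Measure (EuclideanSpace ℝ (Fin q))) (s : ℝ) : Prop :=
  0 < s ∧ ∃ ε₀ C₁ C₂ : ℝ, 0 < ε₀ ∧ 0 < C₁ ∧ 0 < C₂ ∧
    ∀ x ∈ μ.support, ∀ ε : ℝ, 0 < ε → ε < ε₀ →
      ENNReal.ofReal (C₁ * ε ^ s) ≤ μ (Metric.closedBall x ε) ∧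
      μ (Metric.closedBall x ε) ≤ ENNReal.ofReal (C₂ * ε ^ s)

/-- The family `𝒟_k` of the sets of at least one and at most `k` points of `ℝ^q`. -/
def Codebook (q k : ℕ) : Set (Finset (EuclideanSpace ℝ (Fin q))) :=
  {α | 1 ≤ α.card ∧ α.card ≤ k}

/-- The geometric mean error `exp (∫ log d(x, α) dμ(x))` of the finite set `α`. For a non-empty `α`
and an Ahlfors-David probability measure `μ`, the integrand is `μ`-integrable (the support of `μ` is
then compact and balls of radius `ε` have measure `O(ε ^ s)`, `s > 0`) and `α` is `μ`-null, so that
the value of the logarithm at `0` is irrelevant and the integral is the usual one. -/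
def geomMeanError {q : ℕ} (μ : Measure (EuclideanSpace ℝ (Fin q)))
    (α : Finset (EuclideanSpace ℝ (Fin q))) : ℝ :=
  Real.exp (∫ x, Real.log (Metric.infDist x (α : Set (EuclideanSpace ℝ (Fin q)))) ∂μ)

/-- The `k`-th quantization error of order zero: the infimum of the geometric mean errors of the
sets in `𝒟_k`. -/
def quantError {q : ℕ} (μ : Measure (EuclideanSpace ℝ (Fin q))) (k : ℕ) : ℝ :=
  ⨅ α : Codebook q k, geomMeanError μ (α : Finset (EuclideanSpace ℝ (Fin q)))

/-- `C_k(μ)`: the collection of the `k`-optimal sets for `μ` for the geometric mean error. -/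
def optimalSets {q : ℕ} (μ : Measure (EuclideanSpace ℝ (Fin q))) (k : ℕ) :
    Set (Finset (EuclideanSpace ℝ (Fin q))) :=
  {α | α ∈ Codebook q k ∧ geomMeanError μ α = quantError μ k}

/-- The Voronoi region `W(a | α)`. -/
def voronoiRegion {q : ℕ} (α : Finset (EuclideanSpace ℝ (Fin q))) (a : EuclideanSpace ℝ (Fin q)) :
    Set (EuclideanSpace ℝ (Fin q)) :=
  {x | Metric.infDist x (α : Set (EuclideanSpace ℝ (Fin q))) = dist x a}

/-- `(P a)_{a ∈ α}` is a Voronoi partition with respect to `α`: a partition of `ℝ^q` into Borel sets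
with `P a ⊆ W(a | α)`. The values of `P` outside `α` play no role. -/
structure IsVoronoiPartition {q : ℕ} (α : Finset (EuclideanSpace ℝ (Fin q)))
    (P : EuclideanSpace ℝ (Fin q) → Set (EuclideanSpace ℝ (Fin q))) : Prop where
  measurableSet : ∀ a ∈ α, MeasurableSet (P a)
  pairwiseDisjoint : (α : Set (EuclideanSpace ℝ (Fin q))).PairwiseDisjoint P
  iUnion_eq : (⋃ a ∈ α, P a) = Set.univ
  subset_region : ∀ a ∈ α, P a ⊆ voronoiRegion α a

end GeomMeanQuant

end

/-!
The error is studied through its logarithm `I(α) = ∫ log d(x, α) dμ(x)`. Everything rests on comparing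
the cost of removing a point from a set with the gain of adding a point to it; for Ahlfors-David
measures both can be read off from local data.

*Cost.* Removing `a` from `α` changes the integrand only on the exclusive region `U_a` of the points
strictly closer to `a` than to the rest of `α`, and there by at most `log (1 + ρ / d(x, a))`, where
`ρ = d(a, α \ {a})`. As balls of radius `r` have measure `O(r ^ s)`, the truncated singularity
`log⁺ (r / d(x, a))` has integral `O(r ^ s)` (`integral_posLog_le`), and therefore the cost is at most
`log (1 + 1 / M) μ(U_a) + O((M ρ) ^ s)` for every `M > 0` (`logError_erase_sub_le`). Moreover the cost
is `O(μ(U_a))` (`logError_erase_sub_le_measureReal`): either `a` is at distance at least `ρ / 4` from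
the support and the singularity is not seen, or `U_a` contains a ball of radius `ρ / 8` centred in the
support. The regions `U_a` are disjoint, so in a set of `N ≥ 2` points some point can be removed at
cost `O(1 / N)` (`exists_logError_erase_sub_le`).

*Gain.* Adding a point of the support at distance at least `t` from the set lowers `I` by at least a
constant times `t ^ s` (`le_logError_sub_insert`).

For an optimal set, adding any point of the support and removing the cheapest one gives no
improvement; hence the support lies within `O(n ^ (-1 / s))` of the set
(`infDist_rpow_le_of_mem_optimalSets`), so that a cell meets the support inside a ball of that radius.
This bounds the measure of the cell by `O(1 / n)` and its diameter within the support by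
`O(n ^ (-1 / s))`. Conversely, a removed point can be replaced by a point of the support at distance
of order `n ^ (-1 / s)` from the remaining ones, so each removal costs at least a constant over `n`
(`exists_le_logError_erase_sub`). The two upper bounds for the cost then give
`μ(U_a) ≥ const / n` and, with a large `M`, `ρ ≥ const * n ^ (-1 / s)`
(`exists_le_measureReal_exclusiveRegion`). As `U_a` contains the open ball of radius `ρ / 2` about `a`
and is contained in the cell of `a` for every Voronoi partition, the theorem follows.
-/

namespace GeomMeanQuant

open Metric Set Filter Topology

variable {X : Type*} [MetricSpace X] [MeasurableSpace X]

/-! ### Ahlfors-David regularity with global constants -/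

/-- Ahlfors-David regularity of `μ` in normalized form: the support has diameter at most `D`, the
upper bound `μ (B(y, r)) ≤ C r ^ s` holds for all centres and radii, and the lower bound
`c r ^ s ≤ μ (B(x, r))` holds for `x` in the support and all radii up to `D`. -/
structure IsRegular (μ : Measure X) (s c C D : ℝ) : Prop where
  s_pos : 0 < s
  c_pos : 0 < c
  C_pos : 0 < C
  one_le_D : 1 ≤ D
  dist_le : ∀ x ∈ μ.support, ∀ y ∈ μ.support, dist x y ≤ D
  upper : ∀ (y : X) (r : ℝ), 0 < r → μ.real (closedBall y r) ≤ C * r ^ s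
  lower : ∀ x ∈ μ.support, ∀ r : ℝ, 0 < r → r ≤ D → c * r ^ s ≤ μ.real (closedBall x r)

/-- If the balls of a fixed radius centred in the support of a probability measure have measure
bounded below, the support is bounded: each of these balls meets a fixed ball which carries almost
all of the measure. -/
lemma isBounded_support_of_le_measureReal_closedBall [BorelSpace X] {μ : Measure X}
    [IsProbabilityMeasure μ] {ε m : ℝ} (hm : 0 < m)
    (h : ∀ x ∈ μ.support, m ≤ μ.real (closedBall x ε)) : Bornology.IsBounded μ.support := by
  obtain ⟨o⟩ := Measure.nonempty_of_neZero μ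
  have hlim : Tendsto (fun k : ℕ => μ (closedBall o (k : ℝ))) atTop (𝓝 (μ univ)) := by
    rw [← iUnion_closedBall_nat o]
    exact tendsto_measure_iUnion_atTop fun i j hij =>
      closedBall_subset_closedBall (by exact_mod_cast hij)
  have hlim' : Tendsto (fun k : ℕ => μ.real (closedBall o (k : ℝ))) atTop (𝓝 1) := by
    have := (ENNReal.tendsto_toReal (measure_ne_top μ univ)).comp hlim
    simpa [Measure.real, Function.comp_def] using this
  obtain ⟨k, hk⟩ := (hlim'.eventually (lt_mem_nhds (show 1 - m < 1 by linarith))).exists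
  refine (isBounded_closedBall (x := o) (r := k + ε)).subset fun x hx => ?_
  have hne : ¬ Disjoint (closedBall x ε) (closedBall o (k : ℝ)) := by
    intro hd
    have h1 := measureReal_union (μ := μ) hd isClosed_closedBall.measurableSet
    have h2 : μ.real (closedBall x ε ∪ closedBall o (k : ℝ)) ≤ 1 := measureReal_le_one
    linarith [h x hx]
  obtain ⟨z, hz1, hz2⟩ := not_disjoint_iff.1 hne
  rw [mem_closedBall] at *
  linarith [dist_triangle_left x o z]

lemma IsAhlforsDavid.exists_isRegular {q : ℕ} {μ : Measure (EuclideanSpace ℝ (Fin q))}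
    [IsProbabilityMeasure μ] {s : ℝ} (hμ : IsAhlforsDavid μ s) :
    ∃ c C D : ℝ, IsRegular μ s c C D := by
  obtain ⟨hs, ε₀, C₁, C₂, hε, hC₁, hC₂, h⟩ := hμ
  have hlow : ∀ x ∈ μ.support, ∀ ε : ℝ, 0 < ε → ε < ε₀ → C₁ * ε ^ s ≤ μ.real (closedBall x ε) :=
    fun x hx ε h0 h1 => (ENNReal.ofReal_le_iff_le_toReal (measure_ne_top _ _)).1 (h x hx ε h0 h1).1
  have hupp : ∀ x ∈ μ.support, ∀ ε : ℝ, 0 < ε → ε < ε₀ → μ.real (closedBall x ε) ≤ C₂ * ε ^ s :=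
    fun x hx ε h0 h1 => ENNReal.toReal_le_of_le_ofReal (by positivity) (h x hx ε h0 h1).2
  obtain ⟨D₀, hD₀⟩ := isBounded_iff.1 <| isBounded_support_of_le_measureReal_closedBall
    (μ := μ) (m := C₁ * (ε₀ / 2) ^ s) (by positivity)
    fun x hx => hlow x hx (ε₀ / 2) (by linarith) (by linarith)
  have hD : 1 ≤ max D₀ 1 := le_max_right _ _
  have hD' : 0 < max D₀ 1 := by linarith
  set D := max D₀ 1
  have ht : 0 < ε₀ / (D + ε₀) := by positivity
  refine ⟨C₁ * (ε₀ / (D + ε₀)) ^ s, C₂ * 2 ^ s + (2 / ε₀) ^ s, D, hs, by positivity, by positivity,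
    hD, fun x hx y hy => (hD₀ hx hy).trans (le_max_left _ _), fun y r hr => ?_,
    fun x hx r hr hrD => ?_⟩
  · rcases (closedBall y r ∩ μ.support).eq_empty_or_nonempty with he | ⟨x, hxy, hx⟩
    · have h0 : μ.real (closedBall y r) = 0 := by
        rw [measureReal_eq_zero_iff]
        exact measure_mono_null (fun z hz hz' => he.le ⟨hz, hz'⟩) Measure.measure_compl_support
      rw [h0]
      positivity
    · have hsub : closedBall y r ⊆ closedBall x (2 * r) := by
        refine closedBall_subset_closedBall' ?_
        rw [mem_closedBall, dist_comm] at hxy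
        linarith
      rw [add_mul]
      by_cases h2 : 2 * r < ε₀
      · have := (measureReal_mono hsub (measure_ne_top μ _)).trans
          (hupp x hx (2 * r) (by linarith) h2)
        rw [Real.mul_rpow (by norm_num) hr.le, ← mul_assoc] at this
        have : 0 ≤ (2 / ε₀) ^ s * r ^ s := by positivity
        linarith
      · have h3 : 1 ≤ (2 / ε₀) ^ s * r ^ s := by
          rw [← Real.mul_rpow (by positivity) hr.le]
          refine Real.one_le_rpow ?_ hs.le
          rw [div_mul_eq_mul_div, one_le_div hε]
          linarith
        have : 0 ≤ C₂ * 2 ^ s * r ^ s := by positivity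
        linarith [measureReal_le_one (μ := μ) (s := closedBall y r)]
  · have hlt : ε₀ / (D + ε₀) < 1 := by rw [div_lt_one (by positivity)]; linarith
    have h1 : ε₀ / (D + ε₀) * r < ε₀ := by
      calc ε₀ / (D + ε₀) * r ≤ ε₀ / (D + ε₀) * D := by gcongr
        _ < ε₀ := by
          rw [div_mul_eq_mul_div, div_lt_iff₀ (by positivity)]
          nlinarith
    have := hlow x hx _ (by positivity) h1
    rw [Real.mul_rpow ht.le hr.le, ← mul_assoc] at this
    refine this.trans (measureReal_mono (closedBall_subset_closedBall ?_) (measure_ne_top μ _))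
    nlinarith

namespace IsRegular

variable {μ : Measure X} [IsProbabilityMeasure μ] {s c C D : ℝ}

lemma measure_singleton (h : IsRegular μ s c C D) (a : X) : μ {a} = 0 := by
  have hlim : Tendsto (fun r : ℝ => C * r ^ s) (𝓝[>] 0) (𝓝 0) := by
    have : Tendsto (fun r : ℝ => C * r ^ s) (𝓝 0) (𝓝 (C * 0 ^ s)) :=
      ((Real.continuous_rpow_const h.s_pos.le).tendsto 0).const_mul C
    rw [Real.zero_rpow h.s_pos.ne', mul_zero] at this
    exact this.mono_left nhdsWithin_le_nhds
  have hle : μ.real {a} ≤ 0 := by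
    refine ge_of_tendsto hlim (eventually_nhdsWithin_of_forall fun r hr => ?_)
    exact (measureReal_mono (by simpa using (mem_Ioi.1 hr).le) (measure_ne_top μ _)).trans
      (h.upper a r hr)
  exact (measureReal_eq_zero_iff (measure_ne_top μ _)).1 (le_antisymm hle measureReal_nonneg)

lemma measure_finset (h : IsRegular μ s c C D) (α : Finset X) : μ (α : Set X) = 0 :=
  haveI : NullSingletonClass μ := ⟨h.measure_singleton⟩
  α.measure_zero μ

lemma ae_notMem (h : IsRegular μ s c C D) (α : Finset X) : ∀ᵐ x ∂μ, x ∉ α :=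
  measure_eq_zero_iff_ae_notMem.1 (h.measure_finset α)

variable [SecondCountableTopology X]

lemma exists_mem_support_notMem (h : IsRegular μ s c C D) (α : Finset X) :
    ∃ x ∈ μ.support, x ∉ α :=
  (Eventually.and (f := ae μ) (p := (· ∈ μ.support)) Measure.support_mem_ae
    (h.ae_notMem α)).exists

/-! ### Logarithmic singularities and integrability -/

variable [BorelSpace X]

lemma lintegral_posLog_le (h : IsRegular μ s c C D) (a : X) {r : ℝ} (hr : 0 < r) :
    ∫⁻ x, ENNReal.ofReal (Real.posLog (r / dist x a)) ∂μ ≤ ENNReal.ofReal (C / s * r ^ s) := by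
  have hs := h.s_pos
  have hC := h.C_pos
  have hmeas : Measurable fun x => Real.posLog (r / dist x a) :=
    measurable_const.max (Real.measurable_log.comp
      (measurable_const.div (measurable_id.dist measurable_const)))
  rw [lintegral_eq_lintegral_meas_le μ (Eventually.of_forall fun _ => Real.posLog_nonneg)
    hmeas.aemeasurable]
  have hint : IntegrableOn (fun t : ℝ => C * r ^ s * Real.exp (-s * t)) (Ioi 0) :=
    (integrableOn_exp_mul_Ioi (neg_lt_zero.2 hs) 0).const_mul _
  calc ∫⁻ t in Ioi (0 : ℝ), μ {x | t ≤ Real.posLog (r / dist x a)}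
      ≤ ∫⁻ t in Ioi (0 : ℝ), ENNReal.ofReal (C * r ^ s * Real.exp (-s * t)) := by
        refine setLIntegral_mono' measurableSet_Ioi fun t ht => ?_
        have hsub : {x | t ≤ Real.posLog (r / dist x a)} ⊆ closedBall a (r * Real.exp (-t)) := by
          intro x hx
          have ht0 : 0 < t := ht
          have h1 : t ≤ Real.log (r / dist x a) := by
            rcases le_max_iff.1 (show t ≤ max 0 (Real.log (r / dist x a)) from hx) with h1 | h1
            · linarith
            · exact h1
          have hd : 0 < dist x a := by
            refine lt_of_le_of_ne dist_nonneg fun h0 => ?_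
            rw [← h0, div_zero, Real.log_zero] at h1
            linarith
          rw [Real.le_log_iff_exp_le (by positivity), le_div_iff₀ hd] at h1
          rw [mem_closedBall, Real.exp_neg, ← div_eq_mul_inv, le_div_iff₀ (Real.exp_pos t)]
          linarith
        refine (measure_mono hsub).trans ?_
        rw [← ofReal_measureReal]
        refine ENNReal.ofReal_le_ofReal ((h.upper a _ (by positivity)).trans_eq ?_)
        rw [Real.mul_rpow hr.le (Real.exp_pos _).le, ← Real.exp_mul, mul_assoc]
        ring_nf
    _ = ENNReal.ofReal (∫ t in Ioi (0 : ℝ), C * r ^ s * Real.exp (-s * t)) :=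
        (ofReal_integral_eq_lintegral_ofReal hint
          (Eventually.of_forall fun t => by positivity)).symm
    _ = ENNReal.ofReal (C / s * r ^ s) := by
        rw [integral_const_mul, integral_exp_mul_Ioi (neg_lt_zero.2 hs)]
        congr 1
        simp
        field_simp

lemma integrable_posLog (h : IsRegular μ s c C D) (a : X) {r : ℝ} (hr : 0 < r) :
    Integrable (fun x => Real.posLog (r / dist x a)) μ := by
  have hmeas : Measurable fun x => Real.posLog (r / dist x a) :=
    measurable_const.max (Real.measurable_log.comp
      (measurable_const.div (measurable_id.dist measurable_const)))
  refine ⟨hmeas.aestronglyMeasurable, ?_⟩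
  rw [hasFiniteIntegral_iff_ofReal (Eventually.of_forall fun _ => Real.posLog_nonneg)]
  exact (h.lintegral_posLog_le a hr).trans_lt ENNReal.ofReal_lt_top

/-- The logarithmic singularity at a point, truncated at radius `r`, has mass `O(r ^ s)`. -/
lemma integral_posLog_le (h : IsRegular μ s c C D) (a : X) {r : ℝ} (hr : 0 < r) :
    ∫ x, Real.posLog (r / dist x a) ∂μ ≤ C / s * r ^ s := by
  have hs := h.s_pos
  have hC := h.C_pos
  rw [integral_eq_lintegral_of_nonneg_ae (Eventually.of_forall fun _ => Real.posLog_nonneg)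
    (h.integrable_posLog a hr).aestronglyMeasurable]
  exact ENNReal.toReal_le_of_le_ofReal (by positivity) (h.lintegral_posLog_le a hr)

/-- The negative part of the logarithm is controlled by the singularities at the points of `α`, the
positive part by the boundedness of the support. -/
lemma integrable_log_infDist (h : IsRegular μ s c C D) {α : Finset X} (hα : α.Nonempty) :
    Integrable (fun x => Real.log (infDist x (α : Set X))) μ := by
  have hne : (α : Set X).Nonempty := hα
  obtain ⟨x₀, hx₀⟩ : μ.support.Nonempty := Measure.nonempty_support (NeZero.ne μ)
  have hmeas : Measurable fun x => Real.log (infDist x (α : Set X)) :=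
    Real.measurable_log.comp measurable_infDist
  have hbound : Integrable (fun x => Real.posLog (infDist x₀ (α : Set X) + D)
      + ∑ a ∈ α, Real.posLog (1 / dist x a)) μ :=
    (integrable_const _).add (integrable_finsetSum _ fun a _ => h.integrable_posLog a one_pos)
  refine hbound.mono' hmeas.aestronglyMeasurable ?_
  filter_upwards [Measure.support_mem_ae (μ := μ)] with x hx
  obtain ⟨a, ha, hxa⟩ := α.finite_toSet.isCompact.exists_infDist_eq_dist hne x
  have h1 : Real.posLog (1 / dist x a) ≤ ∑ a ∈ α, Real.posLog (1 / dist x a) :=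
    Finset.single_le_sum (f := fun a => Real.posLog (1 / dist x a))
      (fun _ _ => Real.posLog_nonneg) ha
  have h2 : Real.posLog (dist x a) ≤ Real.posLog (infDist x₀ (α : Set X) + D) := by
    refine Real.posLog_le_posLog dist_nonneg ?_
    rw [← hxa]
    linarith [infDist_le_infDist_add_dist (x := x) (y := x₀) (s := (α : Set X)),
      h.dist_le x hx x₀ hx₀]
  have h3 : |Real.log (dist x a)| = Real.posLog (dist x a) + Real.posLog (1 / dist x a) := by
    rw [one_div]
    simp only [Real.posLog, Real.log_inv]
    rcases le_total 0 (Real.log (dist x a)) with h | h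
    · rw [abs_of_nonneg h, max_eq_right h, max_eq_left (by linarith), add_zero]
    · rw [abs_of_nonpos h, max_eq_left h, max_eq_right (by linarith), zero_add]
  rw [Real.norm_eq_abs, hxa, h3]
  linarith

end IsRegular
end GeomMeanQuant

namespace GeomMeanQuant

open Metric Set Filter Topology

variable {X : Type*} [MetricSpace X]

/-! ### The region lost by removing a point -/

section Region

variable [DecidableEq X] {α : Finset X} {a b x : X}

/-- The points which are strictly closer to `a` than to the other points of `α`. For `α = {a}` the
set is empty, as `infDist x ∅ = 0`. -/
def exclusiveRegion (α : Finset X) (a : X) : Set X :=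
  {x | infDist x (α : Set X) < infDist x (α.erase a : Set X)}

lemma measurableSet_exclusiveRegion [MeasurableSpace X] [BorelSpace X] (α : Finset X) (a : X) :
    MeasurableSet (exclusiveRegion α a) :=
  measurableSet_lt measurable_infDist measurable_infDist

lemma infDist_le_infDist_erase (hne : (α.erase a).Nonempty) :
    infDist x (α : Set X) ≤ infDist x (α.erase a : Set X) :=
  infDist_le_infDist_of_subset (by exact_mod_cast α.erase_subset a) (by exact_mod_cast hne)

lemma infDist_eq_of_mem_exclusiveRegion (ha : a ∈ α) (hx : x ∈ exclusiveRegion α a) :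
    infDist x (α : Set X) = dist x a := by
  obtain ⟨b, hb, hxb⟩ := α.finite_toSet.isCompact.exists_infDist_eq_dist ⟨a, ha⟩ x
  by_cases hba : b = a
  · rw [hxb, hba]
  · have : infDist x (α.erase a : Set X) ≤ dist x b :=
      infDist_le_dist_of_mem (Finset.mem_coe.2 (Finset.mem_erase.2 ⟨hba, hb⟩))
    exact absurd hx (not_lt.2 (hxb ▸ this))

lemma notMem_exclusiveRegion_of_infDist_eq (hb : b ∈ α) (hba : b ≠ a)
    (hx : infDist x (α : Set X) = dist x b) : x ∉ exclusiveRegion α a := by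
  have : infDist x (α.erase a : Set X) ≤ dist x b :=
    infDist_le_dist_of_mem (Finset.mem_coe.2 (Finset.mem_erase.2 ⟨hba, hb⟩))
  exact not_lt.2 (this.trans_eq hx.symm)

lemma pairwiseDisjoint_exclusiveRegion (α : Finset X) :
    (α : Set X).PairwiseDisjoint (exclusiveRegion α) := fun _ ha _ _ hab =>
  disjoint_left.2 fun _ hxa hxb =>
    notMem_exclusiveRegion_of_infDist_eq ha hab (infDist_eq_of_mem_exclusiveRegion ha hxa) hxb

lemma mem_exclusiveRegion_of_dist_lt (ha : a ∈ α)
    (hx : dist x a < infDist a (α.erase a : Set X) / 2) : x ∈ exclusiveRegion α a := by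
  have h1 : infDist x (α : Set X) ≤ dist x a := infDist_le_dist_of_mem ha
  have h2 := infDist_le_infDist_add_dist (x := a) (y := x) (s := (α.erase a : Set X))
  rw [dist_comm] at h2
  exact lt_of_le_of_lt h1 (by linarith)

lemma infDist_erase_pos (hne : (α.erase a).Nonempty) : 0 < infDist a (α.erase a : Set X) :=
  ((α.erase a).finite_toSet.isClosed.notMem_iff_infDist_pos (by exact_mod_cast hne)).1 (by simp)

lemma log_one_add_div_le {ρ d M : ℝ} (hρ : 0 < ρ) (hd : 0 < d) (hM : 0 < M) :
    Real.log (1 + ρ / d) ≤ Real.log (1 + 1 / M) + Real.posLog (M * ρ / d) := by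
  rcases le_total (M * ρ) d with h | h
  · have : Real.log (1 + ρ / d) ≤ Real.log (1 + 1 / M) := by
      refine Real.log_le_log (by positivity) (add_le_add_right ?_ _)
      rw [div_le_div_iff₀ hd hM]
      linarith
    linarith [Real.posLog_nonneg (x := M * ρ / d)]
  · calc Real.log (1 + ρ / d) ≤ Real.log ((1 + 1 / M) * (M * ρ / d)) := by
          refine Real.log_le_log (by positivity) ?_
          have : (1 + 1 / M) * (M * ρ / d) = M * ρ / d + ρ / d := by field_simp
          rw [this]
          exact add_le_add_left ((one_le_div hd).2 h) _
      _ = Real.log (1 + 1 / M) + Real.log (M * ρ / d) :=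
          Real.log_mul (by positivity) (by positivity)
      _ ≤ _ := add_le_add_right (le_max_right _ _) _

/-- Removing `a` from `α` changes the integrand only on the exclusive region of `a`, and there the
second nearest point is within `infDist a (α.erase a) + dist x a`. -/
lemma log_infDist_erase_sub_le (ha : a ∈ α) (hne : (α.erase a).Nonempty) (hx : x ∉ α) :
    Real.log (infDist x (α.erase a : Set X)) - Real.log (infDist x (α : Set X)) ≤
      (exclusiveRegion α a).indicator
        (fun x => Real.log (1 + infDist a (α.erase a : Set X) / dist x a)) x := by
  have hd : 0 < dist x a := dist_pos.2 fun h => hx (h ▸ ha)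
  have hρ := infDist_erase_pos hne
  by_cases hxU : x ∈ exclusiveRegion α a
  · rw [indicator_of_mem hxU, infDist_eq_of_mem_exclusiveRegion ha hxU, sub_le_iff_le_add,
      ← Real.log_mul (by positivity) hd.ne']
    have hpos : 0 < infDist x (α.erase a : Set X) := lt_of_le_of_lt infDist_nonneg hxU
    refine Real.log_le_log hpos ?_
    rw [add_mul, one_mul, div_mul_cancel₀ _ hd.ne']
    linarith [infDist_le_infDist_add_dist (x := x) (y := a) (s := (α.erase a : Set X))]
  · rw [indicator_of_notMem hxU,
      le_antisymm (infDist_le_infDist_erase hne) (not_lt.1 hxU), sub_self]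

end Region

/-! ### The cost of removing a point -/

variable [MeasurableSpace X]

/-- The logarithm of the geometric mean error of `α`. -/
noncomputable def logError (μ : Measure X) (α : Finset X) : ℝ :=
  ∫ x, Real.log (infDist x (α : Set X)) ∂μ

namespace IsRegular

variable [BorelSpace X] [SecondCountableTopology X] {μ : Measure X} [IsProbabilityMeasure μ]
  {s c C D : ℝ} [DecidableEq X] {α : Finset X} {a : X}

/-- The cost of removing `a` in terms of its separation `ρ` from the other points: far from `a`, at
distance `≥ M ρ`, the integrand grows by at most `log (1 + 1 / M)`, and the rest is the truncated
logarithmic singularity at `a`. -/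
lemma logError_erase_sub_le (h : IsRegular μ s c C D) (ha : a ∈ α) (hne : (α.erase a).Nonempty)
    {M : ℝ} (hM : 0 < M) :
    logError μ (α.erase a) - logError μ α ≤ Real.log (1 + 1 / M) * μ.real (exclusiveRegion α a)
      + C / s * (M * infDist a (α.erase a : Set X)) ^ s := by
  have hρ := infDist_erase_pos hne
  have hMρ : 0 < M * infDist a (α.erase a : Set X) := by positivity
  have hU := measurableSet_exclusiveRegion α a
  have hi1 : Integrable ((exclusiveRegion α a).indicator fun _ => Real.log (1 + 1 / M)) μ :=
    (integrable_const _).indicator hU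
  have hi2 := h.integrable_posLog a hMρ
  rw [logError, logError, ← integral_sub (h.integrable_log_infDist hne)
    (h.integrable_log_infDist ⟨a, ha⟩)]
  calc _ ≤ ∫ x, ((exclusiveRegion α a).indicator (fun _ => Real.log (1 + 1 / M)) x
        + Real.posLog (M * infDist a (α.erase a : Set X) / dist x a)) ∂μ := by
        refine integral_mono_ae ((h.integrable_log_infDist hne).sub
          (h.integrable_log_infDist ⟨a, ha⟩)) (hi1.add hi2) ?_
        filter_upwards [h.ae_notMem α] with x hx
        refine (log_infDist_erase_sub_le ha hne hx).trans ?_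
        have hd : 0 < dist x a := dist_pos.2 fun h => hx (h ▸ ha)
        by_cases hxU : x ∈ exclusiveRegion α a
        · rw [indicator_of_mem hxU, indicator_of_mem hxU]
          exact log_one_add_div_le hρ hd hM
        · rw [indicator_of_notMem hxU, indicator_of_notMem hxU, zero_add]
          exact Real.posLog_nonneg
    _ ≤ _ := by
        rw [integral_add hi1 hi2, integral_indicator_const _ hU, smul_eq_mul, mul_comm]
        exact add_le_add_right (h.integral_posLog_le a hMρ) _

/-- If `a` is far from the support relative to its separation, the singularity plays no role. -/
lemma logError_erase_sub_le_of_far (h : IsRegular μ s c C D) (ha : a ∈ α)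
    (hne : (α.erase a).Nonempty)
    (hfar : ∀ x ∈ μ.support, infDist a (α.erase a : Set X) / 4 ≤ dist x a) :
    logError μ (α.erase a) - logError μ α ≤ Real.log 5 * μ.real (exclusiveRegion α a) := by
  have hρ := infDist_erase_pos hne
  have hU := measurableSet_exclusiveRegion α a
  rw [logError, logError, ← integral_sub (h.integrable_log_infDist hne)
    (h.integrable_log_infDist ⟨a, ha⟩), mul_comm, ← smul_eq_mul, ← integral_indicator_const _ hU]
  refine integral_mono_ae ((h.integrable_log_infDist hne).sub
    (h.integrable_log_infDist ⟨a, ha⟩)) ((integrable_const _).indicator hU) ?_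
  filter_upwards [h.ae_notMem α, Measure.support_mem_ae (μ := μ)] with x hx hxs
  refine (log_infDist_erase_sub_le ha hne hx).trans (indicator_le_indicator ?_)
  have hd : 0 < dist x a := dist_pos.2 fun h => hx (h ▸ ha)
  refine Real.log_le_log (by positivity) ?_
  have : infDist a (α.erase a : Set X) / dist x a ≤ 4 := by
    rw [div_le_iff₀ hd]
    linarith [hfar x hxs]
  linarith

/-- The cost of removing a point is at most a constant times the measure of its exclusive region:
if `a` is close to the support relative to its separation `ρ`, the region contains a ball of radius
`ρ / 8` centred in the support and hence has measure at least of order `ρ ^ s`. -/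
lemma logError_erase_sub_le_measureReal (h : IsRegular μ s c C D) (ha : a ∈ α)
    (hne : (α.erase a).Nonempty) (hlt : μ.real (exclusiveRegion α a) < 1) :
    logError μ (α.erase a) - logError μ α ≤
      (Real.log 5 + C / s * 8 ^ s / c) * μ.real (exclusiveRegion α a) := by
  have hs := h.s_pos
  have hc := h.c_pos
  have hC := h.C_pos
  have hρ := infDist_erase_pos hne
  set ρ := infDist a (α.erase a : Set X) with hρ_def
  by_cases hfar : ∀ x ∈ μ.support, ρ / 4 ≤ dist x a
  · refine (h.logError_erase_sub_le_of_far ha hne hfar).trans ?_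
    gcongr
    have : 0 ≤ C / s * 8 ^ s / c := by positivity
    linarith
  · push Not at hfar
    obtain ⟨x, hx, hxa⟩ := hfar
    have hρD : ρ / 8 ≤ D := by
      by_contra! hD
      -- Otherwise the exclusive region contains the whole support.
      refine hlt.not_ge ?_
      have : μ (exclusiveRegion α a) = 1 := by
        rw [prob_compl_eq_zero_iff (measurableSet_exclusiveRegion α a) |>.symm]
        refine measure_mono_null (compl_subset_compl.2 fun y hys => ?_)
          (Measure.measure_compl_support (μ := μ))
        refine mem_exclusiveRegion_of_dist_lt ha ?_
        linarith [dist_triangle y x a, h.dist_le y hys x hx]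
      simp [Measure.real, this]
    have hball : closedBall x (ρ / 8) ⊆ exclusiveRegion α a := fun y hy =>
      mem_exclusiveRegion_of_dist_lt ha <| by
        linarith [dist_triangle y x a, mem_closedBall.1 hy]
    have h1 := (h.lower x hx (ρ / 8) (by positivity) hρD).trans
      (measureReal_mono hball (measure_ne_top μ _))
    have h2 := h.logError_erase_sub_le ha hne one_pos
    rw [one_mul, ← hρ_def] at h2
    have h3 : C / s * ρ ^ s = C / s * 8 ^ s / c * (c * (ρ / 8) ^ s) := by
      rw [Real.div_rpow hρ.le (by norm_num)]
      field_simp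
    have h4 : C / s * ρ ^ s ≤ C / s * 8 ^ s / c * μ.real (exclusiveRegion α a) := by
      rw [h3]
      gcongr
    have h5 : Real.log (1 + 1 / 1) * μ.real (exclusiveRegion α a) ≤
        Real.log 5 * μ.real (exclusiveRegion α a) := by
      gcongr
      norm_num
    rw [add_mul]
    linarith

/-- Some point can be removed at cost `O(1 / card α)`, since the exclusive regions are disjoint. -/
lemma exists_logError_erase_sub_le (h : IsRegular μ s c C D) (hcard : 2 ≤ α.card) :
    ∃ a ∈ α, logError μ (α.erase a) - logError μ α ≤
      (Real.log 5 + C / s * 8 ^ s / c) / α.card := by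
  have hs := h.s_pos
  have hc := h.c_pos
  have hC := h.C_pos
  have hne : α.Nonempty := Finset.card_pos.1 (by lia)
  have hpos : (0 : ℝ) < α.card := by exact_mod_cast Finset.card_pos.2 hne
  have hsum : ∑ a ∈ α, μ.real (exclusiveRegion α a) ≤ ∑ _a ∈ α, (1 / α.card : ℝ) := by
    rw [← measureReal_biUnion_finset (pairwiseDisjoint_exclusiveRegion α)
      fun a _ => measurableSet_exclusiveRegion α a]
    refine measureReal_le_one.trans_eq ?_
    rw [Finset.sum_const, nsmul_eq_mul, mul_one_div_cancel hpos.ne']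
  obtain ⟨a, ha, hle⟩ := Finset.exists_le_of_sum_le hne hsum
  refine ⟨a, ha, ?_⟩
  have hlt : (1 / α.card : ℝ) < 1 := by
    rw [div_lt_one hpos]
    exact_mod_cast hcard
  have hlog : 0 < Real.log 5 := Real.log_pos (by norm_num)
  refine (h.logError_erase_sub_le_measureReal ha ?_ (hle.trans_lt hlt)).trans ?_
  · rw [← Finset.card_pos, Finset.card_erase_of_mem ha]
    lia
  · exact (mul_le_mul_of_nonneg_left hle (by positivity)).trans_eq (mul_one_div _ _)

/-! ### The gain of adding a point -/

/-- Adding a point `x` of the support at distance at least `t` from `β` lowers the logarithmic error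
by at least a constant times `t ^ s`: the distance shrinks by a factor `3` on `B(x, t / 4)`. -/
lemma le_logError_sub_insert (h : IsRegular μ s c C D) {β : Finset X} (hβ : β.Nonempty) {x : X}
    (hx : x ∈ μ.support) {t : ℝ} (ht : 0 < t) (htD : t ≤ 4 * D) (htx : t ≤ infDist x (β : Set X)) :
    c * (t / 4) ^ s ≤ logError μ β - logError μ (insert x β) := by
  have hi1 := h.integrable_log_infDist hβ
  have hi2 := h.integrable_log_infDist (β.insert_nonempty x)
  refine (h.lower x hx (t / 4) (by positivity) (by linarith)).trans ?_
  rw [logError, logError, ← integral_sub hi1 hi2, ← mul_one (μ.real _), ← smul_eq_mul,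
    ← integral_indicator_const _ isClosed_closedBall.measurableSet]
  refine integral_mono_ae ((integrable_const _).indicator isClosed_closedBall.measurableSet)
    (hi1.sub hi2) ?_
  filter_upwards [h.ae_notMem (insert x β)] with y hy
  have hpos : 0 < infDist y ((insert x β : Finset X) : Set X) :=
    ((insert x β).finite_toSet.isClosed.notMem_iff_infDist_pos ⟨x, by simp⟩).1
      (by exact_mod_cast hy)
  have hle : infDist y ((insert x β : Finset X) : Set X) ≤ infDist y (β : Set X) :=
    infDist_le_infDist_of_subset (by simp) (by exact_mod_cast hβ)
  by_cases hyx : y ∈ closedBall x (t / 4)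
  · rw [indicator_of_mem hyx, ← Real.log_div (hpos.trans_le hle).ne' hpos.ne',
      Real.le_log_iff_exp_le (div_pos (hpos.trans_le hle) hpos), le_div_iff₀ hpos]
    have h1 : infDist y ((insert x β : Finset X) : Set X) ≤ dist y x :=
      infDist_le_dist_of_mem (by simp)
    have h2 := infDist_le_infDist_add_dist (x := x) (y := y) (s := (β : Set X))
    rw [dist_comm] at h2
    rw [mem_closedBall] at hyx
    nlinarith [Real.exp_one_lt_d9, Real.exp_pos 1]
  · rw [indicator_of_notMem hyx]
    exact sub_nonneg.2 (Real.log_le_log hpos hle)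

end IsRegular
end GeomMeanQuant

namespace GeomMeanQuant

open Metric Set Filter Topology

/-! ### Optimal sets -/

variable {q : ℕ} {μ : Measure (EuclideanSpace ℝ (Fin q))} {n : ℕ}
  {α β : Finset (EuclideanSpace ℝ (Fin q))} {a x : EuclideanSpace ℝ (Fin q)} {s c C D : ℝ}

lemma logError_le_of_mem_optimalSets (hα : α ∈ optimalSets μ n) (hβ : β.Nonempty)
    (hcard : β.card ≤ n) : logError μ α ≤ logError μ β := by
  have hle : quantError μ n ≤ geomMeanError μ β :=
    ciInf_le (f := fun α : Codebook q n => geomMeanError μ (α : Finset (EuclideanSpace ℝ (Fin q))))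
      ⟨0, by rintro _ ⟨γ, rfl⟩; exact (Real.exp_pos _).le⟩ ⟨β, Finset.card_pos.2 hβ, hcard⟩
  rw [← hα.2] at hle
  exact Real.exp_le_exp.1 hle

lemma nonempty_of_mem_optimalSets (hα : α ∈ optimalSets μ n) : α.Nonempty :=
  Finset.card_pos.1 hα.1.1

namespace IsRegular

variable [IsProbabilityMeasure μ]

/-- An optimal set uses all `n` points, since adding a point of the support strictly lowers the
error. -/
lemma card_eq_of_mem_optimalSets (h : IsRegular μ s c C D) (hα : α ∈ optimalSets μ n) :
    α.card = n := by
  classical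
  by_contra hcard
  have hne := nonempty_of_mem_optimalSets hα
  have hc := h.c_pos
  have hD := h.one_le_D
  obtain ⟨x, hx, hxα⟩ := h.exists_mem_support_notMem α
  have hpos : 0 < infDist x (α : Set _) :=
    (α.finite_toSet.isClosed.notMem_iff_infDist_pos hne).1 (by exact_mod_cast hxα)
  have ht : 0 < min (infDist x (α : Set _)) (4 * D) := lt_min hpos (by linarith)
  have h1 := h.le_logError_sub_insert hne hx ht (min_le_right _ _) (min_le_left _ _)
  have h2 := logError_le_of_mem_optimalSets hα (α.insert_nonempty x)
    ((Finset.card_insert_le x α).trans (by have := hα.1.2; lia))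
  have : 0 < c * (min (infDist x (α : Set _)) (4 * D) / 4) ^ s := by positivity
  linarith

/-- An optimal set beats a single point of the support, whose distance from the support is at most
`D`, so it has to come near the support. -/
lemma infDist_le_of_mem_optimalSets (h : IsRegular μ s c C D) (hα : α ∈ optimalSets μ n)
    (hx : x ∈ μ.support) : infDist x (α : Set _) ≤ 2 * D := by
  by_contra! hlt
  have hD := h.one_le_D
  have hne := nonempty_of_mem_optimalSets hα
  have h1 : logError μ α ≤ logError μ {x} :=
    logError_le_of_mem_optimalSets hα (Finset.singleton_nonempty x)
      (by simpa using hα.1.1.trans hα.1.2)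
  have h2 : logError μ {x} ≤ Real.log D := by
    rw [logError, ← (by simp : ∫ _, Real.log D ∂μ = Real.log D)]
    refine integral_mono_ae (h.integrable_log_infDist (Finset.singleton_nonempty x))
      (integrable_const _) ?_
    filter_upwards [Measure.support_mem_ae (μ := μ), h.ae_notMem {x}] with y hy hyx
    rw [Finset.coe_singleton, infDist_singleton]
    exact Real.log_le_log (dist_pos.2 (by simpa using hyx)) (h.dist_le y hy x hx)
  have h3 : Real.log (infDist x (α : Set _) - D) ≤ logError μ α := by
    rw [logError, ← (by simp : ∫ _, Real.log (infDist x (α : Set _) - D) ∂μ =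
      Real.log (infDist x (α : Set _) - D))]
    refine integral_mono_ae (integrable_const _) (h.integrable_log_infDist hne) ?_
    filter_upwards [Measure.support_mem_ae (μ := μ)] with y hy
    refine Real.log_le_log (by linarith) ?_
    linarith [infDist_le_infDist_add_dist (x := x) (y := y) (s := (α : Set _)), h.dist_le x hx y hy]
  have h4 : Real.log D < Real.log (infDist x (α : Set _) - D) :=
    Real.log_lt_log (by linarith) (by linarith)
  linarith

/-- Covering radius of an optimal set: adding a point `x` of the support and then removing the
cheapest point does not lower the error, so that the gain at `x` is `O(1 / n)`. -/
lemma infDist_rpow_le_of_mem_optimalSets (h : IsRegular μ s c C D) (hα : α ∈ optimalSets μ n)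
    (hx : x ∈ μ.support) :
    infDist x (α : Set _) ^ s ≤ (Real.log 5 + C / s * 8 ^ s / c) * 4 ^ s / c / n := by
  classical
  have hs := h.s_pos
  have hc := h.c_pos
  have hC := h.C_pos
  have hD := h.one_le_D
  have hlog : 0 < Real.log 5 := Real.log_pos (by norm_num)
  have hne := nonempty_of_mem_optimalSets hα
  have hcard := h.card_eq_of_mem_optimalSets hα
  have hn : 0 < n := hcard ▸ Finset.card_pos.2 hne
  by_cases hxα : x ∈ α
  · rw [infDist_zero_of_mem (Finset.mem_coe.2 hxα), Real.zero_rpow hs.ne']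
    positivity
  have hpos : 0 < infDist x (α : Set _) :=
    (α.finite_toSet.isClosed.notMem_iff_infDist_pos hne).1 (by exact_mod_cast hxα)
  have hcard' : (insert x α).card = n + 1 := by rw [Finset.card_insert_of_notMem hxα, hcard]
  obtain ⟨b, hb, hle⟩ := h.exists_logError_erase_sub_le (α := insert x α) (by rw [hcard']; lia)
  have hcard'' : ((insert x α).erase b).card = n := by
    rw [Finset.card_erase_of_mem hb, hcard', Nat.add_sub_cancel]
  have h1 := logError_le_of_mem_optimalSets hα (Finset.card_pos.1 (hcard''.symm ▸ hn)) hcard''.le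
  have h2 := h.le_logError_sub_insert hne hx hpos
    (by linarith [h.infDist_le_of_mem_optimalSets hα hx]) le_rfl
  have h3 : (Real.log 5 + C / s * 8 ^ s / c) / (insert x α).card ≤
      (Real.log 5 + C / s * 8 ^ s / c) / n := by
    rw [hcard']
    gcongr
    lia
  have h4 : c * (infDist x (α : Set _) / 4) ^ s ≤ (Real.log 5 + C / s * 8 ^ s / c) / n := by
    linarith
  rw [Real.div_rpow hpos.le (by norm_num), ← mul_div_assoc, div_le_iff₀ (by positivity)] at h4
  rw [div_right_comm, le_div_iff₀ hc]
  calc _ = c * infDist x (α : Set _) ^ s := mul_comm _ _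
    _ ≤ _ := h4
    _ = _ := by ring

/-- Some point of the support is at distance of order `n ^ (-1 / s)` from a given set of at most `n`
points, as balls of a smaller radius around these points do not carry the whole measure. -/
lemma exists_lt_infDist (h : IsRegular μ s c C D) (hne : β.Nonempty) (hcard : β.card ≤ n) {t : ℝ}
    (ht : 0 < t) (htn : n * (C * t ^ s) < 1) : ∃ x ∈ μ.support, t < infDist x (β : Set _) := by
  have hC := h.C_pos
  by_contra! hcon
  have hcover : μ.support ⊆ ⋃ b ∈ β, closedBall b t := fun x hx => by
    obtain ⟨b, hb, hxb⟩ := β.finite_toSet.isCompact.exists_infDist_eq_dist hne x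
    exact mem_biUnion hb (mem_closedBall.2 (hxb ▸ hcon x hx))
  have h1 : μ.real (⋃ b ∈ β, closedBall b t) = 1 := by
    have : μ (⋃ b ∈ β, closedBall b t) = 1 := by
      rw [← prob_compl_eq_zero_iff (β.measurableSet_biUnion fun _ _ =>
        isClosed_closedBall.measurableSet)]
      exact measure_mono_null (compl_subset_compl.2 hcover) Measure.measure_compl_support
    simp [Measure.real, this]
  have h2 : μ.real (⋃ b ∈ β, closedBall b t) ≤ n * (C * t ^ s) :=
    calc _ ≤ ∑ b ∈ β, μ.real (closedBall b t) := measureReal_biUnion_finset_le _ _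
      _ ≤ ∑ _b ∈ β, C * t ^ s := Finset.sum_le_sum fun b _ => h.upper b t ht
      _ = β.card * (C * t ^ s) := by rw [Finset.sum_const, nsmul_eq_mul]
      _ ≤ n * (C * t ^ s) := by gcongr
  linarith

/-- Removing a point from an optimal set costs at least a constant over `n`: the removed point can
be replaced by a point of the support far from the remaining ones. -/
lemma exists_le_logError_erase_sub [DecidableEq (EuclideanSpace ℝ (Fin q))]
    (h : IsRegular μ s c C D) :
    ∃ κ : ℝ, 0 < κ ∧ ∀ n : ℕ, ∀ α ∈ optimalSets μ n, ∀ a ∈ α, (α.erase a).Nonempty →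
      κ / n ≤ logError μ (α.erase a) - logError μ α := by
  have hs := h.s_pos
  have hc := h.c_pos
  have hC := h.C_pos
  have hD := h.one_le_D
  -- The radius `t` below satisfies `t ^ s = τ / n`.
  obtain ⟨τ, hτ, hτC, hτD⟩ : ∃ τ : ℝ, 0 < τ ∧ C * τ < 1 ∧ τ ≤ D ^ s := by
    refine ⟨min (1 / (2 * C)) (D ^ s), by positivity, ?_, min_le_right _ _⟩
    calc C * min (1 / (2 * C)) (D ^ s) ≤ C * (1 / (2 * C)) := by gcongr; exact min_le_left _ _
      _ < 1 := by field_simp; norm_num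
  refine ⟨c * (τ / 4 ^ s), by positivity, fun n α hα a ha hne => ?_⟩
  have hcard := h.card_eq_of_mem_optimalSets hα
  have hn : 1 ≤ n := hα.1.1.trans hα.1.2
  have hn' : (1 : ℝ) ≤ n := by exact_mod_cast hn
  have hn0 : (0 : ℝ) < n := by linarith
  set t := (τ / n) ^ s⁻¹ with ht_def
  have ht : 0 < t := by positivity
  have hts : t ^ s = τ / n := by
    rw [ht_def, ← Real.rpow_mul (by positivity), inv_mul_cancel₀ hs.ne', Real.rpow_one]
  have htD : t ≤ D := by
    rw [← Real.rpow_le_rpow_iff ht.le (by linarith) hs, hts]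
    exact (div_le_self hτ.le hn').trans hτD
  have herase : (α.erase a).card + 1 = n := by rw [Finset.card_erase_add_one ha, hcard]
  obtain ⟨x, hx, hlt⟩ := h.exists_lt_infDist (n := n) hne (by lia) ht (by
    rw [hts, mul_left_comm, mul_div_cancel₀ _ hn0.ne']
    exact hτC)
  have h1 := h.le_logError_sub_insert hne hx ht (by linarith) hlt.le
  have h2 := logError_le_of_mem_optimalSets hα ((α.erase a).insert_nonempty x)
    ((Finset.card_insert_le _ _).trans herase.le)
  rw [Real.div_rpow ht.le (by norm_num), hts] at h1
  calc c * (τ / 4 ^ s) / n = c * (τ / n / 4 ^ s) := by ring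
    _ ≤ _ := by linarith

/-- Bounds for the exclusive regions of an optimal set: their measure is at least of order `1 / n`,
and the separation of the points is at least of order `n ^ (-1 / s)`. -/
lemma exists_le_measureReal_exclusiveRegion [DecidableEq (EuclideanSpace ℝ (Fin q))]
    (h : IsRegular μ s c C D) {d : ℝ} (hd : 0 < d) :
    ∃ κ σ : ℝ, 0 < κ ∧ κ ≤ 1 ∧ 0 < σ ∧
      ∀ n : ℕ, ∀ α ∈ optimalSets μ n, ∀ a ∈ α, (α.erase a).Nonempty →
        μ.real (exclusiveRegion α a) ≤ d / n → κ / n ≤ μ.real (exclusiveRegion α a) ∧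
          σ / n ≤ infDist a (α.erase a : Set _) ^ s := by
  have hs := h.s_pos
  have hc := h.c_pos
  have hC := h.C_pos
  have hlog : 0 < Real.log 5 := Real.log_pos (by norm_num)
  obtain ⟨κ, hκ, hcost⟩ := h.exists_le_logError_erase_sub
  set A := Real.log 5 + C / s * 8 ^ s / c with hA_def
  have hA : 0 < A := by positivity
  -- With this choice of `M`, the far part of the cost is at most `κ / (2 n)`.
  set M := 2 * d / κ with hM_def
  have hM : 0 < M := by positivity
  refine ⟨min (κ / A) 1, κ / 2 / (C / s * M ^ s), by positivity, min_le_right _ _, by positivity,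
    fun n α hα a ha hne hle => ?_⟩
  have hn : (1 : ℝ) ≤ n := by exact_mod_cast hα.1.1.trans hα.1.2
  have hn0 : (0 : ℝ) < n := by linarith
  have hρ := infDist_erase_pos hne
  have h1 := hcost n α hα a ha hne
  constructor
  · by_cases hlt : μ.real (exclusiveRegion α a) < 1
    · have h2 := h1.trans (h.logError_erase_sub_le_measureReal ha hne hlt)
      calc min (κ / A) 1 / n ≤ κ / A / n := by gcongr; exact min_le_left _ _
        _ = κ / n / A := div_right_comm _ _ _
        _ ≤ _ := by rwa [div_le_iff₀' hA]
    · calc min (κ / A) 1 / n ≤ 1 / 1 := by gcongr; exact min_le_right _ _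
        _ ≤ _ := by simpa using hlt
  · have h2 := h1.trans (h.logError_erase_sub_le ha hne hM)
    have h3 : Real.log (1 + 1 / M) * μ.real (exclusiveRegion α a) ≤ κ / 2 / n :=
      calc _ ≤ 1 / M * (d / n) := by
            gcongr
            linarith [Real.log_le_sub_one_of_pos (show 0 < 1 + 1 / M by positivity)]
        _ = κ / 2 / n := by rw [hM_def]; field_simp
    rw [Real.mul_rpow hM.le hρ.le] at h2
    rw [div_right_comm, div_le_iff₀' (by positivity)]
    have h4 : κ / n = κ / 2 / n + κ / 2 / n := by ring
    linarith

end IsRegular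

/-! ### Voronoi partitions -/

variable {P : EuclideanSpace ℝ (Fin q) → Set (EuclideanSpace ℝ (Fin q))}

lemma IsVoronoiPartition.exists_mem (hP : IsVoronoiPartition α P)
    (x : EuclideanSpace ℝ (Fin q)) : ∃ b ∈ α, x ∈ P b := by
  simpa using hP.iUnion_eq.ge (mem_univ x)

lemma IsVoronoiPartition.exclusiveRegion_subset [DecidableEq (EuclideanSpace ℝ (Fin q))]
    (hP : IsVoronoiPartition α P) (a : EuclideanSpace ℝ (Fin q)) :
    exclusiveRegion α a ⊆ P a := by
  intro x hx
  obtain ⟨b, hb, hxb⟩ := hP.exists_mem x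
  by_cases hba : b = a
  · exact hba ▸ hxb
  · exact absurd hx (notMem_exclusiveRegion_of_infDist_eq hb hba (hP.subset_region b hb hxb))

lemma IsVoronoiPartition.eq_univ_of_card_eq_one (hP : IsVoronoiPartition α P)
    (hcard : α.card = 1) (ha : a ∈ α) : P a = univ := by
  refine eq_univ_of_forall fun x => ?_
  obtain ⟨b, hb, hxb⟩ := hP.exists_mem x
  rwa [Finset.card_le_one.1 hcard.le a ha b hb]

lemma IsVoronoiPartition.inter_support_subset (hP : IsVoronoiPartition α P) (ha : a ∈ α) {r : ℝ}
    (hr : ∀ x ∈ μ.support, infDist x (α : Set _) ≤ r) : P a ∩ μ.support ⊆ closedBall a r :=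
  fun x hx => mem_closedBall.2 ((hP.subset_region a ha hx.1).symm.le.trans (hr x hx.2))

end GeomMeanQuant

open GeomMeanQuant

theorem theorem1p1 (q : ℕ) (μ : Measure (EuclideanSpace ℝ (Fin q))) [IsProbabilityMeasure μ]
    (s : ℝ) (hμ : GeomMeanQuant.IsAhlforsDavid μ s) :
    ∃ d₁ d₂ d₃ : ℝ, 0 < d₁ ∧ 0 < d₂ ∧ 0 < d₃ ∧
      ∀ n : ℕ, 1 ≤ n → ∀ α ∈ GeomMeanQuant.optimalSets μ n,
        ∀ P : EuclideanSpace ℝ (Fin q) → Set (EuclideanSpace ℝ (Fin q)),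
          GeomMeanQuant.IsVoronoiPartition α P →
            ∀ a ∈ α,
              d₁ / (n : ℝ) ≤ μ.real (P a) ∧ μ.real (P a) ≤ d₂ / (n : ℝ) ∧
              Metric.closedBall a (d₃ * Metric.diam (P a ∩ μ.support)) ⊆ P a := by
  classical
  obtain ⟨c, C, D, h⟩ := hμ.exists_isRegular
  have hs := h.s_pos
  have hc := h.c_pos
  have hC := h.C_pos
  have hlog : 0 < Real.log 5 := Real.log_pos (by norm_num)
  -- The covering radius `r` of an optimal set satisfies `r ^ s ≤ A / n`.
  set A := (Real.log 5 + C / s * 8 ^ s / c) * 4 ^ s / c with hA_def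
  have hA : 0 < A := by positivity
  obtain ⟨κ, σ, hκ, hκ1, hσ, hbound⟩ :=
    h.exists_le_measureReal_exclusiveRegion (d := C * A) (by positivity)
  refine ⟨κ, C * A, (σ / A) ^ s⁻¹ / 8, hκ, by positivity, by positivity,
    fun n hn α hα P hP a ha => ?_⟩
  have hn1 : (1 : ℝ) ≤ n := by exact_mod_cast hn
  have hn0 : (0 : ℝ) < n := by linarith
  set r := (A / n) ^ s⁻¹ with hr_def
  have hr : 0 < r := by positivity
  have hrs : r ^ s = A / n := by
    rw [hr_def, ← Real.rpow_mul (by positivity), inv_mul_cancel₀ hs.ne', Real.rpow_one]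
  have hsub : P a ∩ μ.support ⊆ Metric.closedBall a r := by
    refine hP.inter_support_subset ha fun x hx => ?_
    rw [← Real.rpow_le_rpow_iff Metric.infDist_nonneg hr.le hs, hrs]
    exact h.infDist_rpow_le_of_mem_optimalSets hα hx
  have hupper : μ.real (P a) ≤ C * A / n := by
    rw [mul_div_assoc, ← hrs]
    refine le_trans ?_ (h.upper a r hr)
    refine ENNReal.toReal_mono (measure_ne_top μ _) (measure_mono_ae ?_)
    filter_upwards [Measure.support_mem_ae (μ := μ)] with x hx hxP
    exact hsub ⟨hxP, hx⟩
  by_cases hcard : α.card = 1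
  · have huniv := hP.eq_univ_of_card_eq_one hcard ha
    refine ⟨?_, hupper, by simp [huniv]⟩
    rw [huniv, probReal_univ, div_le_one hn0]
    linarith
  have hne : (α.erase a).Nonempty := by
    have := hα.1.1
    rw [← Finset.card_pos, Finset.card_erase_of_mem ha]
    lia
  have hU : μ.real (exclusiveRegion α a) ≤ μ.real (P a) :=
    measureReal_mono (hP.exclusiveRegion_subset a) (measure_ne_top μ _)
  obtain ⟨hlower, hsep⟩ := hbound n α hα a ha hne (hU.trans hupper)
  refine ⟨hlower.trans hU, hupper, fun x hx => hP.exclusiveRegion_subset a ?_⟩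
  have hρ := infDist_erase_pos hne
  refine mem_exclusiveRegion_of_dist_lt ha ((Metric.mem_closedBall.1 hx).trans_lt ?_)
  have hdiam : Metric.diam (P a ∩ μ.support) ≤ 2 * r :=
    (Metric.diam_mono hsub Metric.isBounded_closedBall).trans (Metric.diam_closedBall hr.le)
  have hr' : (σ / A) ^ s⁻¹ * r ≤ Metric.infDist a (α.erase a : Set _) := by
    rw [← Real.rpow_le_rpow_iff (by positivity) hρ.le hs, Real.mul_rpow (by positivity) hr.le, hrs,
      ← Real.rpow_mul (by positivity), inv_mul_cancel₀ hs.ne', Real.rpow_one]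
    calc σ / A * (A / n) = σ / n := by field_simp
      _ ≤ _ := hsep
  calc (σ / A) ^ s⁻¹ / 8 * Metric.diam (P a ∩ μ.support) ≤ (σ / A) ^ s⁻¹ / 8 * (2 * r) := by gcongr
    _ = (σ / A) ^ s⁻¹ * r / 4 := by ring
    _ < _ := by linarith
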